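/- Work in a nonstandard model $A\mapsto{}^{*}\!A$ of the superstructure over a set containing $\mathbb R$ and $X$, satisfying the extension principle, the transfer principle and (at least countable) saturation. Let $(X,d)$ be a bounded $\sigma$-compact metric space with Borel $\sigma$-algebra $\mathcal B(X)$. A charge on $(X,\mathcal B(X))$ is a finitely additive probability measure on $\mathcal B(X)$; for charges $\mu,\mu'$ put $$W(\mu,\mu')=\sup\Big\{\Big|\int f\,d\mu-\int f\,d\mu'\Big| : f:X\to\mathbb R,\ |f(x)-f(y)|\le d(x,y)\ \text{for all } x,y\in X\Big\}.$$ An internal probability measure on $({}^{*}X,{}^{*}\mathcal B(X))$ is an element of the nonstandard extension of the set of all charges on $(X,\mathcal B(X))$. Let $\nu$ be such a measure, with Loeb extension $({}^{*}X,\overline{{}^{*}\mathcal B(X)},\overline{\nu})$: a set $A\subseteq{}^{*}X$ belongs to $\overline{{}^{*}\mathcal B(X)}$ iff for every standard real $\varepsilon>0$ there are $B,C\in{}^{*}\mathcal B(X)$ with $B\subseteq A\subseteq C$ and $\nu(C)-\nu(B)<\varepsilon$, and then $\overline\nu(A)$ is the supremum of the standard parts of $\nu(B)$ over all $B\in{}^{*}\mathcal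 B(X)$ with $B\subseteq A$. For $C\subseteq X$ let $\mathrm{st}^{-1}(C)\subseteq{}^{*}X$ be the set of all points $y$ that lie in the monad $\bigcap\{{}^{*}U: U\ni x\text{ open}\}$ of some $x\in C$. The external push-down of $\nu$ is $\nu_p(C)=\overline\nu(\mathrm{st}^{-1}(C))$, defined for those $C\subseteq X$ with $\mathrm{st}^{-1}(C)\in\overline{{}^{*}\mathcal B(X)}$. **Theorem.** Suppose that $\nu_p$ is a countably additive probability measure on $(X,\mathcal B(X))$ (in particular, it is defined on all of $\mathcal B(X)$). Then $${}^{*}W(\nu,{}^{*}\nu_p)\approx 0,$$ that is, $|{}^{*}W(\nu,{}^{*}\nu_p)|<\varepsilon$ for every standard real $\varepsilon>0$. -/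

import Mathlib

open MeasureTheory

universe u v

/-! ## Charges and the Wasserstein distance -/

section Charges

variable {X : Type u} [MeasurableSpace X]

/-- A charge, i.e. a finitely additive probability measure on the measurable subsets of `X`.
Only the values of `P` on measurable sets matter. -/
structure IsCharge (P : Set X → ℝ) : Prop where
  empty : P ∅ = 0
  univ : P Set.univ = 1
  nonneg : ∀ A, MeasurableSet A → 0 ≤ P A
  union : ∀ A B, MeasurableSet A → MeasurableSet B → Disjoint A B → P (A ∪ B) = P A + P B

/-- `P`, restricted to the measurable sets, is a countably additive probability measure. -/
structure IsCountablyAdditiveProbability (P : Set X → ℝ) : Prop where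
  univ : P Set.univ = 1
  nonneg : ∀ A, MeasurableSet A → 0 ≤ P A
  iUnion : ∀ A : ℕ → Set X, (∀ i, MeasurableSet (A i)) → Pairwise (fun i j => Disjoint (A i) (A j)) →
    HasSum (fun i => P (A i)) (P (⋃ i, A i))

/-- The integral of a measurable simple function with respect to a charge. -/
noncomputable def simpleIntegral (P : Set X → ℝ) (s : SimpleFunc X ℝ) : ℝ :=
  ∑ r ∈ s.range, r * P (s ⁻¹' {r})

/-- The integral of a bounded measurable function `f` with respect to a charge `P`:
the supremum of the integrals of the measurable simple functions below `f`. (Such an `f` is a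
uniform limit of simple functions, so this is also the infimum of the integrals of the simple
functions above `f`.) -/
noncomputable def chargeIntegral (P : Set X → ℝ) (f : X → ℝ) : ℝ :=
  sSup {r : ℝ | ∃ s : SimpleFunc X ℝ, (∀ x, s x ≤ f x) ∧ simpleIntegral P s = r}

/-- The Wasserstein distance of two charges on a bounded metric space. -/
noncomputable def wasserstein {X : Type u} [MetricSpace X] [MeasurableSpace X]
    (P Q : Set X → ℝ) : ℝ :=
  sSup {r : ℝ | ∃ f : X → ℝ, LipschitzWith 1 f ∧ r = |chargeIntegral P f - chargeIntegral Q f|}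

end Charges

/-! ## The (finite type) superstructure over `X` and `ℝ` and its bounded formulas -/

/-- The finite types over two basic sorts, the points of a space and the real numbers. -/
inductive HType : Type
  | pt : HType
  | real : HType
  | prod : HType → HType → HType
  | set : HType → HType
  | fn : HType → HType → HType

/-- The set of all standard objects of a given type over `X` and `ℝ`: all pairs, all subsets,
all functions. -/
@[reducible] def HType.El (X : Type u) : HType → Type u
  | .pt => X
  | .real => ULift.{u} ℝ
  | .prod s t => s.El X × t.El X
  | .set t => Set (t.El X)
  | .fn s t => s.El X → t.El X

/-- A structure in which formulas about objects of finite type can be interpreted. -/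
structure HStructure where
  Carrier : HType → Type v
  pair : ∀ {s t : HType}, Carrier s → Carrier t → Carrier (.prod s t)
  mem : ∀ {t : HType}, Carrier t → Carrier (.set t) → Prop
  app : ∀ {s t : HType}, Carrier (.fn s t) → Carrier s → Carrier t

/-- The standard superstructure over `X` and `ℝ`. -/
def stdStructure (X : Type u) : HStructure.{u} where
  Carrier := HType.El X
  pair a b := (a, b)
  mem a A := a ∈ A
  app f a := f a

/-- Variables of type `t` in a context, in de Bruijn style. -/
inductive HVar : List HType → HType → Type
  | zero {Γ : List HType} {t : HType} : HVar (t :: Γ) t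
  | succ {Γ : List HType} {s t : HType} : HVar Γ t → HVar (s :: Γ) t

/-- Terms: variables, ordered pairs, values of functions. -/
inductive HTerm (Γ : List HType) : HType → Type
  | var {t : HType} : HVar Γ t → HTerm Γ t
  | pair {s t : HType} : HTerm Γ s → HTerm Γ t → HTerm Γ (.prod s t)
  | app {s t : HType} : HTerm Γ (.fn s t) → HTerm Γ s → HTerm Γ t

/-- Formulas built from `=` and `∈` by connectives and quantifiers. Every quantifier is bounded:
it ranges over the set of all objects of one type. The other connectives and `∃` are definable. -/
inductive HFormula : List HType → Type
  | eq {Γ : List HType} {t : HType} : HTerm Γ t → HTerm Γ t → HFormula Γ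
  | mem {Γ : List HType} {t : HType} : HTerm Γ t → HTerm Γ (.set t) → HFormula Γ
  | neg {Γ : List HType} : HFormula Γ → HFormula Γ
  | and {Γ : List HType} : HFormula Γ → HFormula Γ → HFormula Γ
  | all {Γ : List HType} (t : HType) : HFormula (t :: Γ) → HFormula Γ

namespace HStructure

variable (N : HStructure.{v})

/-- Assignments of objects to the variables of a context. -/
abbrev Env (Γ : List HType) : Type v := ∀ t : HType, HVar Γ t → N.Carrier t

/-- Extend an assignment by a value for the newest variable. -/
def extend {Γ : List HType} {s : HType} (e : N.Env Γ) (a : N.Carrier s) : N.Env (s :: Γ)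
  | _, .zero => a
  | _, .succ x => e _ x

/-- The value of a term. -/
def val {Γ : List HType} (e : N.Env Γ) : ∀ {t : HType}, HTerm Γ t → N.Carrier t
  | _, .var x => e _ x
  | _, .pair a b => N.pair (val e a) (val e b)
  | _, .app f a => N.app (val e f) (val e a)

/-- Truth of a formula. -/
def Holds : ∀ {Γ : List HType}, N.Env Γ → HFormula Γ → Prop
  | _, e, .eq a b => N.val e a = N.val e b
  | _, e, .mem a b => N.mem (N.val e a) (N.val e b)
  | _, e, .neg φ => ¬ Holds e φ
  | _, e, .and φ ψ => Holds e φ ∧ Holds e ψ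
  | _, e, .all t φ => ∀ a : N.Carrier t, Holds (N.extend e a) φ

end HStructure

/-! ## Nonstandard models -/

/-- A nonstandard model of the superstructure over `X` and `ℝ`: the internal objects
`Carrier t` of every type `t`, and a map `star` from standard to internal objects, subject to
the extension principle, the transfer principle and (countable) saturation. An internal set
`A : Carrier (.set t)` is determined by its extension `{x | mem x A}`, by transfer. -/
structure NonstandardModel (X : Type u) extends HStructure.{v} where
  star : ∀ {t : HType}, t.El X → Carrier t
  /-- Extension: `*ℝ` is a proper extension of `ℝ` (`star` is injective by transfer). -/
  proper : ∃ r : Carrier .real, ∀ x : ULift.{u} ℝ, r ≠ star (t := .real) x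
  /-- Transfer: a formula is true of standard objects iff it is true of their images. -/
  transfer : ∀ {Γ : List HType} (φ : HFormula Γ) (e : (stdStructure X).Env Γ),
    (stdStructure X).Holds e φ ↔ toHStructure.Holds (fun t x => star (e t x)) φ
  /-- Saturation: a countable family of internal sets with the finite intersection property
  has a common element. -/
  saturation : ∀ {t : HType} (A : ℕ → Carrier (.set t)),
    (∀ n, ∃ x, ∀ i ≤ n, mem x (A i)) → ∃ x, ∀ i, mem x (A i)

namespace NonstandardModel

variable {X : Type u} (M : NonstandardModel.{u, v} X)

/-- The points of `*X`. -/
abbrev Pt : Type v := M.Carrier .pt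

/-- The elements of `*ℝ`. -/
abbrev HReal : Type v := M.Carrier .real

/-- The internal subsets of `*X`. -/
abbrev ISet : Type v := M.Carrier (.set .pt)

/-- The internal functions from internal subsets of `*X` to `*ℝ`. -/
abbrev ISetFun : Type v := M.Carrier (.fn (.set .pt) .real)

/-- The element `*r` of `*ℝ`. -/
def starReal (r : ℝ) : M.HReal := M.star (t := .real) (ULift.up r)

/-- The internal set `*A`. -/
def starSet (A : Set X) : M.ISet := M.star (t := .set .pt) A

/-- The internal function `*P`. -/
def starSetFun (P : Set X → ℝ) : M.ISetFun :=
  M.star (t := .fn (.set .pt) .real) (fun A => ULift.up (P A))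

/-- `a - b < ε` in `*ℝ`, for a standard real `ε`. -/
def SubLT (a b : M.HReal) (ε : ℝ) : Prop :=
  M.mem (M.pair a b) (M.star (t := .set (.prod .real .real)) {p | p.1.down - p.2.down < ε})

/-- `a ≈ b`: the distance of `a` and `b` is less than every positive standard real. -/
def Approx (a b : M.HReal) : Prop :=
  ∀ ε : ℝ, 0 < ε → M.SubLT a b ε ∧ M.SubLT b a ε

/-- `B ∈ *𝓑(X)`. -/
def IsInternalBorel [MeasurableSpace X] (B : M.ISet) : Prop :=
  M.mem B (M.star (t := .set (.set .pt)) {A : Set X | MeasurableSet A})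

/-- Internal probability measures on `(*X, *𝓑(X))`: the elements of the nonstandard extension of
the set of all charges. -/
def IsInternalProbability [MeasurableSpace X] (ν : M.ISetFun) : Prop :=
  M.mem ν (M.star (t := .set (.fn (.set .pt) .real))
    {P : Set X → ULift.{u} ℝ | IsCharge fun A => (P A).down})

/-- The nonstandard extension `*W` of the Wasserstein distance. -/
noncomputable def starWasserstein [MetricSpace X] [MeasurableSpace X] (μ ν : M.ISetFun) : M.HReal :=
  M.app (M.star (t := .fn (.prod (.fn (.set .pt) .real) (.fn (.set .pt) .real)) .real)
    (fun p => ULift.up (wasserstein (fun A => (p.1 A).down) (fun A => (p.2 A).down))))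
    (M.pair μ ν)

/-- The (external) set of all elements of an internal set. -/
def ext (B : M.ISet) : Set M.Pt := {y | M.mem y B}

/-- The Loeb `σ`-algebra of `ν`: the sets `A ⊆ *X` that are sandwiched between internal Borel sets
whose measures differ by less than any given positive standard real. -/
def IsLoebMeasurable [MeasurableSpace X] (ν : M.ISetFun) (A : Set M.Pt) : Prop :=
  ∀ ε : ℝ, 0 < ε → ∃ B C : M.ISet, M.IsInternalBorel B ∧ M.IsInternalBorel C ∧
    M.ext B ⊆ A ∧ A ⊆ M.ext C ∧ M.SubLT (M.app ν C) (M.app ν B) ε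

/-- The Loeb measure of a Loeb measurable set `A`: the supremum of the standard parts of `ν B` over
the internal Borel sets `B ⊆ A`. -/
noncomputable def loeb [MeasurableSpace X] (ν : M.ISetFun) (A : Set M.Pt) : ℝ :=
  sSup {r : ℝ | ∃ B : M.ISet, M.IsInternalBorel B ∧ M.ext B ⊆ A ∧
    M.Approx (M.app ν B) (M.starReal r)}

/-- The monad of a standard point: the intersection of all `*U`, for `U` an open set around it. -/
def monad [TopologicalSpace X] (x : X) : Set M.Pt :=
  {y | ∀ U : Set X, IsOpen U → x ∈ U → y ∈ M.ext (M.starSet U)}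

/-- `st⁻¹(C)`: the near-standard points of `*X` whose standard part lies in `C`. -/
def stPreimage [TopologicalSpace X] (C : Set X) : Set M.Pt :=
  {y | ∃ x ∈ C, y ∈ M.monad x}

/-- The domain of the external push-down of `ν`. -/
def pushDownDomain [TopologicalSpace X] [MeasurableSpace X] (ν : M.ISetFun) : Set (Set X) :=
  {C | M.IsLoebMeasurable ν (M.stPreimage C)}

/-- The external push-down `C ↦ (Loeb measure of ν)(st⁻¹(C))`, meaningful on `pushDownDomain`. -/
noncomputable def pushDown [TopologicalSpace X] [MeasurableSpace X] (ν : M.ISetFun) :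
    Set X → ℝ :=
  fun C => M.loeb ν (M.stPreimage C)

end NonstandardModel

/-! ## Integration with respect to a charge -/

/-! Write `P` for the push-down. An open set contains the monads of its points in its extension, so
st⁻¹(G) ⊆ *G and `P G` is at most the standard part of ν(*G) (`mem_star_lt_of_lt_pushDown`). Being
countably additive on a separable space, `P` has almost all its mass on finitely many disjoint small
open sets `G i` (`exists_disjoint_isOpen_small`). The ν(*G i) sum to at most 1 and the `P (G i)` to
almost 1, so these one-sided bounds force ν(*G i) to be close to `P (G i)` for all `i` together. A
1-Lipschitz function is nearly constant on each `G i` and has bounded oscillation elsewhere, so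
every standard charge satisfying the same finitely many inequalities is Wasserstein-close to `P`
(`IsCharge.wasserstein_le`). ν lies in the extension of this set of charges, and transfer gives the
bound for ν. -/

namespace IsCharge

open SimpleFunc

variable {X : Type u} [MeasurableSpace X] {P Q : Set X → ℝ}

/-- A set function as a family of scalar operators, for use with `SimpleFunc.setToSimpleFunc`. -/
noncomputable def toCLM (P : Set X → ℝ) (A : Set X) : ℝ →L[ℝ] ℝ :=
  P A • ContinuousLinearMap.id ℝ ℝ

theorem simpleIntegral_eq_setToSimpleFunc (P : Set X → ℝ) (s : SimpleFunc X ℝ) :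
    simpleIntegral P s = s.setToSimpleFunc (toCLM P) := by
  simp [simpleIntegral, SimpleFunc.setToSimpleFunc, toCLM, mul_comm]

theorem toCLM_empty (hP : IsCharge P) : toCLM P ∅ = 0 := by
  simp [toCLM, hP.empty]

/-- With the zero measure as reference, the finiteness and integrability side conditions of
`setToSimpleFunc` are vacuous, so its calculus applies to a merely finitely additive `P`. -/
theorem finMeasAdditive_toCLM (hP : IsCharge P) :
    FinMeasAdditive (0 : Measure X) (toCLM P) := by
  intro s t hs ht _ _ hst
  simp [toCLM, hP.union s t hs ht hst, add_smul]

theorem mono (hP : IsCharge P) {A B : Set X} (hA : MeasurableSet A) (hB : MeasurableSet B)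
    (h : A ⊆ B) : P A ≤ P B := by
  have h1 := hP.union A (B \ A) hA (hB.diff hA) Set.disjoint_sdiff_right
  rw [Set.union_sdiff_cancel h] at h1
  linarith [hP.nonneg _ (hB.diff hA)]

theorem sum_le_one (hP : IsCharge P) {ι : Type*} (I : Finset ι) {G : ι → Set X}
    (hG : ∀ i, MeasurableSet (G i)) (hd : Pairwise fun i j => Disjoint (G i) (G j)) :
    ∑ i ∈ I, P (G i) ≤ 1 := by
  classical
  have key : ∑ i ∈ I, P (G i) = P (⋃ i ∈ I, G i) := by
    induction I using Finset.induction_on with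
    | empty => simp [hP.empty]
    | insert i I hi ih =>
      rw [Finset.sum_insert hi, Finset.set_biUnion_insert, ih, hP.union _ _ (hG i)
        (Finset.measurableSet_biUnion _ fun j _ => hG j)]
      refine Set.disjoint_iUnion₂_right.2 fun j hj => hd ?_
      rintro rfl
      exact hi hj
  rw [key, ← hP.univ]
  exact hP.mono (Finset.measurableSet_biUnion _ fun j _ => hG j) .univ (Set.subset_univ _)

theorem simpleIntegral_mono (hP : IsCharge P) {s t : SimpleFunc X ℝ} (h : ∀ x, s x ≤ t x) :
    simpleIntegral P s ≤ simpleIntegral P t := by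
  simp only [simpleIntegral_eq_setToSimpleFunc]
  refine setToSimpleFunc_mono hP.finMeasAdditive_toCLM (fun A hA _ x hx => ?_)
    (integrable_zero_measure) (integrable_zero_measure) h
  simpa [toCLM] using mul_nonneg (hP.nonneg A hA) hx

/-- The majorant `t` bounds the set whose supremum is taken. -/
theorem simpleIntegral_le_chargeIntegral (hP : IsCharge P) {f : X → ℝ} {s t : SimpleFunc X ℝ}
    (hs : ∀ x, s x ≤ f x) (ht : ∀ x, f x ≤ t x) : simpleIntegral P s ≤ chargeIntegral P f := by
  refine le_csSup ⟨simpleIntegral P t, ?_⟩ ⟨s, hs, rfl⟩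
  rintro _ ⟨s', hs', rfl⟩
  exact hP.simpleIntegral_mono fun x => (hs' x).trans (ht x)

/-- The minorant `s` makes the set nonempty, which excludes the default value 0 of `sSup`. -/
theorem chargeIntegral_le_simpleIntegral (hP : IsCharge P) {f : X → ℝ} {s t : SimpleFunc X ℝ}
    (hs : ∀ x, s x ≤ f x) (ht : ∀ x, f x ≤ t x) : chargeIntegral P f ≤ simpleIntegral P t := by
  refine csSup_le ⟨_, s, hs, rfl⟩ ?_
  rintro _ ⟨s', hs', rfl⟩
  exact hP.simpleIntegral_mono fun x => (hs' x).trans (ht x)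

/-- The simple function with value `m + c i` on `G i`, for `i ∈ I`, and `m` elsewhere. -/
noncomputable def stepFunc {ι : Type*} (I : Finset ι) (G : ι → Set X)
    (hG : ∀ i, MeasurableSet (G i)) (m : ℝ) (c : ι → ℝ) : SimpleFunc X ℝ :=
  SimpleFunc.const X m +
    ∑ i ∈ I, SimpleFunc.piecewise (G i) (hG i) (SimpleFunc.const X (c i)) (SimpleFunc.const X 0)

section stepFunc

variable {ι : Type*} {I : Finset ι} {G : ι → Set X} {hG : ∀ i, MeasurableSet (G i)}

theorem stepFunc_apply (m : ℝ) (c : ι → ℝ) (x : X) :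
    stepFunc I G hG m c x = m + ∑ i ∈ I, (G i).indicator (fun _ => c i) x := by
  classical
  have key : (∑ i ∈ I, SimpleFunc.piecewise (G i) (hG i) (SimpleFunc.const X (c i))
      (SimpleFunc.const X 0)) x = ∑ i ∈ I, (G i).indicator (fun _ => c i) x := by
    induction I using Finset.induction_on with
    | empty => simp
    | insert i I hi ih =>
      rw [Finset.sum_insert hi, Finset.sum_insert hi, SimpleFunc.coe_add, Pi.add_apply, ih]
      simp [SimpleFunc.piecewise_apply, Set.indicator_apply]
  rw [stepFunc, SimpleFunc.coe_add, Pi.add_apply, key, SimpleFunc.const_apply]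

theorem stepFunc_apply_of_mem (hd : Pairwise fun i j => Disjoint (G i) (G j)) (m : ℝ) (c : ι → ℝ)
    {i : ι} (hi : i ∈ I) {x : X} (hx : x ∈ G i) : stepFunc I G hG m c x = m + c i := by
  rw [stepFunc_apply, Finset.sum_eq_single_of_mem i hi, Set.indicator_of_mem hx]
  intro j _ hj
  exact Set.indicator_of_notMem (Set.disjoint_right.1 (hd hj) hx) _

theorem stepFunc_apply_of_notMem (m : ℝ) (c : ι → ℝ) {x : X} (hx : ∀ i ∈ I, x ∉ G i) :
    stepFunc I G hG m c x = m := by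
  rw [stepFunc_apply, Finset.sum_eq_zero fun i hi => Set.indicator_of_notMem (hx i hi) _, add_zero]

theorem simpleIntegral_stepFunc (hP : IsCharge P) (m : ℝ) (c : ι → ℝ) :
    simpleIntegral P (stepFunc I G hG m c) = m + ∑ i ∈ I, c i * P (G i) := by
  classical
  have key : (∑ i ∈ I, SimpleFunc.piecewise (G i) (hG i) (SimpleFunc.const X (c i))
      (SimpleFunc.const X 0)).setToSimpleFunc (toCLM P) = ∑ i ∈ I, c i * P (G i) := by
    induction I using Finset.induction_on with
    | empty => simp [SimpleFunc.setToSimpleFunc_zero_apply]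
    | insert i I hi ih =>
      rw [Finset.sum_insert hi, Finset.sum_insert hi,
        setToSimpleFunc_add _ hP.finMeasAdditive_toCLM integrable_zero_measure
        integrable_zero_measure, ih, setToSimpleFunc_indicator _ hP.toCLM_empty]
      simp [toCLM, mul_comm]
  rw [simpleIntegral_eq_setToSimpleFunc, stepFunc, setToSimpleFunc_add _ hP.finMeasAdditive_toCLM
    integrable_zero_measure integrable_zero_measure, key, setToSimpleFunc_const _ hP.toCLM_empty]
  simp [toCLM, hP.univ]

/-- Comparison of the integrals of a bounded function that is almost constant on the sets `G i`. -/
theorem chargeIntegral_le_add (hP : IsCharge P) (hQ : IsCharge Q)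
    (hG : ∀ i, MeasurableSet (G i)) (hd : Pairwise fun i j => Disjoint (G i) (G j))
    {f : X → ℝ} {m D δ : ℝ} (hδ : 0 ≤ δ) (hf : ∀ x, m ≤ f x ∧ f x ≤ m + D) {a : ι → ℝ}
    (ha : ∀ i, 0 ≤ a i ∧ a i ≤ D) (hfa : ∀ i ∈ I, ∀ x ∈ G i, |f x - (m + a i)| ≤ δ) :
    chargeIntegral Q f ≤ chargeIntegral P f + D * (1 - ∑ i ∈ I, Q (G i)) +
      D * ∑ i ∈ I, |Q (G i) - P (G i)| + 2 * δ := by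
  -- `f` lies between two step functions: `m + a i ∓ δ` on `G i`, and the extreme values `m` and `m
  -- + D` off the `G i`.
  have h1 : ∀ x, stepFunc I G hG m (fun i => a i - δ) x ≤ f x := fun x => by
    by_cases hx : ∃ i ∈ I, x ∈ G i
    · obtain ⟨i, hi, hx⟩ := hx
      rw [stepFunc_apply_of_mem hd _ _ hi hx]
      linarith [abs_le.1 (hfa i hi x hx)]
    · push Not at hx
      rw [stepFunc_apply_of_notMem _ _ hx]
      exact (hf x).1
  have h2 : ∀ x, f x ≤ stepFunc I G hG (m + D) (fun i => a i + δ - D) x := fun x => by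
    by_cases hx : ∃ i ∈ I, x ∈ G i
    · obtain ⟨i, hi, hx⟩ := hx
      rw [stepFunc_apply_of_mem hd _ _ hi hx]
      linarith [abs_le.1 (hfa i hi x hx)]
    · push Not at hx
      rw [stepFunc_apply_of_notMem _ _ hx]
      exact (hf x).2
  have h3 := hP.simpleIntegral_le_chargeIntegral h1 h2
  have h4 := hQ.chargeIntegral_le_simpleIntegral h1 h2
  rw [hP.simpleIntegral_stepFunc] at h3
  rw [hQ.simpleIntegral_stepFunc] at h4
  have h5 : ∑ i ∈ I, (a i + δ - D) * Q (G i) - ∑ i ∈ I, (a i - δ) * P (G i) ≤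
      D * ∑ i ∈ I, |Q (G i) - P (G i)| + δ * ∑ i ∈ I, Q (G i) + δ * ∑ i ∈ I, P (G i)
        - D * ∑ i ∈ I, Q (G i) := by
    simp only [Finset.mul_sum, ← Finset.sum_sub_distrib, ← Finset.sum_add_distrib]
    refine Finset.sum_le_sum fun i _ => ?_
    have h6 : a i * (Q (G i) - P (G i)) ≤ D * |Q (G i) - P (G i)| :=
      (mul_le_mul_of_nonneg_left (le_abs_self _) (ha i).1).trans
        (mul_le_mul_of_nonneg_right (ha i).2 (abs_nonneg _))
    linarith
  have h7 := mul_le_mul_of_nonneg_left (hP.sum_le_one I hG hd) hδ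
  have h8 := mul_le_mul_of_nonneg_left (hQ.sum_le_one I hG hd) hδ
  linarith

end stepFunc

end IsCharge

theorem wasserstein_nonneg {X : Type u} [MetricSpace X] [MeasurableSpace X] (P Q : Set X → ℝ) :
    0 ≤ wasserstein P Q := by
  refine Real.sSup_nonneg ?_
  rintro _ ⟨f, -, rfl⟩
  exact abs_nonneg _

/-- Two charges that are close on finitely many disjoint small sets carrying almost all of their
mass are close in the Wasserstein distance. -/
theorem IsCharge.wasserstein_le {X : Type u} [MetricSpace X] [MeasurableSpace X] [Nonempty X]
    {P Q : Set X → ℝ} (hP : IsCharge P) (hQ : IsCharge Q) {ι : Type*} {I : Finset ι}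
    {G : ι → Set X} (hG : ∀ i, MeasurableSet (G i))
    (hd : Pairwise fun i j => Disjoint (G i) (G j)) {D δ η : ℝ} (hD : ∀ x y : X, dist x y ≤ D)
    (hδ : 0 ≤ δ) (c : ι → X) (hc : ∀ i ∈ I, ∀ x ∈ G i, dist x (c i) ≤ δ) (hη : 0 ≤ η)
    (hPη : 1 - η ≤ ∑ i ∈ I, P (G i)) (hPQ : ∑ i ∈ I, |Q (G i) - P (G i)| ≤ η) :
    wasserstein Q P ≤ 6 * D * η + 2 * δ := by
  obtain ⟨x₀⟩ := ‹Nonempty X›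
  have hD0 : 0 ≤ D := dist_nonneg.trans (hD x₀ x₀)
  refine Real.sSup_le ?_ (by positivity)
  rintro _ ⟨f, hf, rfl⟩
  have hf' : ∀ x y, |f x - f y| ≤ dist x y := fun x y => by
    simpa [Real.dist_eq] using hf.dist_le_mul x y
  -- Centring at `x₀` puts the values in an interval of length `2 * D`, which doubles the constant
  -- in the previous estimate.
  have hfm : ∀ x, f x₀ - D ≤ f x ∧ f x ≤ f x₀ - D + 2 * D := fun x => by
    have := abs_le.1 ((hf' x x₀).trans (hD x x₀))
    constructor <;> linarith
  have ha : ∀ i, 0 ≤ f (c i) - (f x₀ - D) ∧ f (c i) - (f x₀ - D) ≤ 2 * D := fun i => by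
    constructor <;> linarith [hfm (c i)]
  have hfa : ∀ i ∈ I, ∀ x ∈ G i, |f x - ((f x₀ - D) + (f (c i) - (f x₀ - D)))| ≤ δ :=
    fun i hi x hx => by
      rw [add_sub_cancel]
      exact (hf' _ _).trans (hc i hi x hx)
  have h1 := hP.chargeIntegral_le_add hQ hG hd hδ hfm ha hfa
  have h2 := hQ.chargeIntegral_le_add hP hG hd hδ hfm ha hfa
  have h3 : ∑ i ∈ I, |P (G i) - Q (G i)| = ∑ i ∈ I, |Q (G i) - P (G i)| :=
    Finset.sum_congr rfl fun i _ => abs_sub_comm _ _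
  have h4 : ∑ i ∈ I, P (G i) - ∑ i ∈ I, Q (G i) ≤ ∑ i ∈ I, |Q (G i) - P (G i)| := by
    rw [← Finset.sum_sub_distrib, ← h3]
    exact Finset.sum_le_sum fun i _ => le_abs_self _
  have h5 : 2 * D * ∑ i ∈ I, |Q (G i) - P (G i)| ≤ 2 * D * η := by gcongr
  have h6 : 2 * D * (1 - ∑ i ∈ I, P (G i)) ≤ 2 * D * η := by gcongr; linarith
  -- `Q` may miss `η` where `P` does, and `η` more by discrepancy; with `h5` this gives the constant
  -- 6.
  have h7 : 2 * D * (1 - ∑ i ∈ I, Q (G i)) ≤ 2 * D * (2 * η) := by gcongr; linarith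
  have h8 : 0 ≤ D * η := by positivity
  rw [h3] at h2
  rw [abs_le]
  constructor <;> linarith

/-! ## Countably additive probabilities -/

namespace IsCountablyAdditiveProbability

variable {X : Type u} [MeasurableSpace X] {P : Set X → ℝ}

theorem empty (hP : IsCountablyAdditiveProbability P) : P ∅ = 0 := by
  have h := hP.iUnion (fun _ => ∅) (fun _ => .empty) fun _ _ _ => disjoint_bot_left
  exact (summable_const_iff _).1 h.summable

/-- The measure with the values of `P` on the measurable sets. -/
theorem exists_measure (hP : IsCountablyAdditiveProbability P) :
    ∃ μ : Measure X, IsProbabilityMeasure μ ∧ ∀ A, MeasurableSet A → P A = μ.real A := by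
  let μ : Measure X := Measure.ofMeasurable (fun A _ => ENNReal.ofReal (P A)) (by simp [hP.empty])
    fun A hA hd => by
      have h := hP.iUnion A hA hd
      rw [← h.tsum_eq, ENNReal.ofReal_tsum_of_nonneg (fun i => hP.nonneg _ (hA i)) h.summable]
  have hμ : ∀ A, MeasurableSet A → μ A = ENNReal.ofReal (P A) := fun A hA =>
    Measure.ofMeasurable_apply A hA
  refine ⟨μ, ⟨by simp [hμ _ .univ, hP.univ]⟩, fun A hA => ?_⟩
  rw [Measure.real, hμ A hA, ENNReal.toReal_ofReal (hP.nonneg A hA)]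

theorem isCharge (hP : IsCountablyAdditiveProbability P) : IsCharge P := by
  obtain ⟨μ, _, hμ⟩ := hP.exists_measure
  refine ⟨hP.empty, hP.univ, hP.nonneg, fun A B hA hB hd => ?_⟩
  rw [hμ _ (hA.union hB), hμ _ hA, hμ _ hB, measureReal_union hd hB]

end IsCountablyAdditiveProbability

/-- In a separable metric space, almost all of the mass of a probability measure is carried by
finitely many disjoint small open sets. -/
theorem exists_disjoint_isOpen_small {X : Type u} [MetricSpace X]
    [TopologicalSpace.SeparableSpace X] [MeasurableSpace X] [BorelSpace X] (μ : Measure X)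
    [IsProbabilityMeasure μ] {δ η : ℝ} (hδ : 0 < δ) (hη : 0 < η) :
    ∃ (n : ℕ) (G : ℕ → Set X) (c : ℕ → X), (∀ i, IsOpen (G i)) ∧
      Pairwise (fun i j => Disjoint (G i) (G j)) ∧ (∀ i, ∀ x ∈ G i, dist x (c i) ≤ δ) ∧
      1 - η < ∑ i ∈ Finset.range n, μ.real (G i) := by
  have : Nonempty X := nonempty_of_isProbabilityMeasure μ
  let c := TopologicalSpace.denseSeq X
  -- Radii above `δ / 2` let the balls cover, radii below `δ` keep them small. Null frontiers
  -- survive the passage to disjoint differences, so taking interiors loses no mass.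
  choose r hr hr0 using fun i => exists_null_frontier_thickening μ {c i} (half_lt_self hδ)
  let B : ℕ → Set X := fun i => Metric.thickening (r i) {c i}
  have hBm : ∀ i, MeasurableSet (B i) := fun i => Metric.isOpen_thickening.measurableSet
  have hU : ⋃ i, disjointed B i = Set.univ := by
    rw [iUnion_disjointed]
    refine Set.eq_univ_of_forall fun x => Set.mem_iUnion.2 ?_
    obtain ⟨i, hi⟩ := (TopologicalSpace.denseRange_denseSeq X).exists_dist_lt x (half_pos hδ)
    exact ⟨i, Metric.mem_thickening_iff.2 ⟨c i, rfl, hi.trans (hr i).1⟩⟩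
  have hfr : ∀ i, μ (frontier (disjointed B i)) = 0 := fun i => by
    refine disjointedRec (p := fun A : Set X => μ (frontier A) = 0) (fun A j hA => ?_) (hr0 i)
    rw [Set.sdiff_eq]
    refine null_frontier_inter hA ?_
    rw [frontier_compl]
    exact hr0 j
  have hint : ∀ i, μ.real (interior (disjointed B i)) = μ.real (disjointed B i) := fun i => by
    rw [Measure.real, Measure.real, measure_congr (interior_ae_eq_of_null_frontier (hfr i))]
  have hsum : HasSum (fun i => μ.real (disjointed B i)) 1 := by
    have h := measure_iUnion (μ := μ) (disjoint_disjointed B) (MeasurableSet.disjointed hBm)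
    rw [hU, measure_univ] at h
    have h' := ENNReal.hasSum_toReal (f := fun i => μ (disjointed B i)) (by rw [← h]; simp)
    rwa [← ENNReal.tsum_toReal_eq (fun i => measure_ne_top _ _), ← h, ENNReal.toReal_one] at h'
  obtain ⟨n, hn⟩ := (hsum.tendsto_sum_nat.eventually (lt_mem_nhds (sub_lt_self 1 hη))).exists
  refine ⟨n, fun i => interior (disjointed B i), c, fun i => isOpen_interior,
    fun i j hij => (disjoint_disjointed B hij).mono interior_subset interior_subset,
    fun i x hx => ?_, by simpa only [hint] using hn⟩
  obtain ⟨y, hy, hxy⟩ := Metric.mem_thickening_iff.1 (disjointed_subset B i (interior_subset hx))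
  rw [Set.mem_singleton_iff.1 hy] at hxy
  exact (hxy.trans (hr i).2).le

/-! ## Consequences of transfer -/

namespace HFormula

/-- Implication. -/
def imp {Γ : List HType} (φ ψ : HFormula Γ) : HFormula Γ := .neg (.and φ (.neg ψ))

theorem holds_imp {N : HStructure.{v}} {Γ : List HType} {e : N.Env Γ} {φ ψ : HFormula Γ} :
    N.Holds e (φ.imp ψ) ↔ (N.Holds e φ → N.Holds e ψ) := by
  simp [imp, HStructure.Holds]

end HFormula

namespace HVar

variable {Γ : List HType} {a b c d e t : HType}

/-- The second newest variable. -/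
abbrev one : HVar (a :: t :: Γ) t := .succ .zero
/-- The third newest variable. -/
abbrev two : HVar (a :: b :: t :: Γ) t := .succ .one
/-- The fourth newest variable. -/
abbrev three : HVar (a :: b :: c :: t :: Γ) t := .succ .two
/-- The fifth newest variable. -/
abbrev four : HVar (a :: b :: c :: d :: t :: Γ) t := .succ .three
/-- The sixth newest variable. -/
abbrev five : HVar (a :: b :: c :: d :: e :: t :: Γ) t := .succ .four

end HVar

/-- The assignment to the empty context. -/
def emptyEnv {X : Type u} : (stdStructure X).Env [] := fun _ x => nomatch x

/-- Add a standard object to an assignment, as the value of the newest variable. -/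
abbrev consEnv {X : Type u} {Γ : List HType} {s : HType} (a : s.El X) (e : (stdStructure X).Env Γ) :
    (stdStructure X).Env (s :: Γ) :=
  HStructure.extend _ e a

namespace NonstandardModel

open HFormula

variable {X : Type u} (M : NonstandardModel.{u, v} X)

theorem mem_star_of_subset {t : HType} {S T : Set (t.El X)} (h : S ⊆ T) {x : M.Carrier t}
    (hx : M.mem x (M.star (t := .set t) S)) : M.mem x (M.star (t := .set t) T) := by
  let φ : HFormula [.set t, .set t] :=
    .all t (.imp (.mem (.var .zero) (.var .one)) (.mem (.var .zero) (.var .two)))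
  let e : (stdStructure X).Env [.set t, .set t] :=
    consEnv S (consEnv T emptyEnv)
  have h1 : (stdStructure X).Holds e φ := fun a => holds_imp.2 fun ha => h ha
  exact holds_imp.1 ((M.transfer φ e).1 h1 x) hx

theorem mem_star_inter {t : HType} {S T : Set (t.El X)} {x : M.Carrier t}
    (hS : M.mem x (M.star (t := .set t) S)) (hT : M.mem x (M.star (t := .set t) T)) :
    M.mem x (M.star (t := .set t) (S ∩ T)) := by
  let φ : HFormula [.set t, .set t, .set t] :=
    .all t (.imp (.and (.mem (.var .zero) (.var .one)) (.mem (.var .zero) (.var .two)))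
      (.mem (.var .zero) (.var .three)))
  let e : (stdStructure X).Env [.set t, .set t, .set t] :=
    consEnv S (consEnv T (consEnv (S ∩ T) emptyEnv))
  have h1 : (stdStructure X).Holds e φ := fun a => holds_imp.2 fun ha => ha
  exact holds_imp.1 ((M.transfer φ e).1 h1 x) ⟨hS, hT⟩

/-- Lets finitely many conditions on ν be gathered into one standard set of charges. -/
theorem mem_star_biInter {t : HType} {ι : Type*} (I : Finset ι) {S : ι → Set (t.El X)}
    {T : Set (t.El X)} {x : M.Carrier t} (hT : M.mem x (M.star (t := .set t) T))
    (hS : ∀ i ∈ I, M.mem x (M.star (t := .set t) (S i))) :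
    M.mem x (M.star (t := .set t) (T ∩ ⋂ i ∈ I, S i)) := by
  classical
  induction I using Finset.induction_on with
  | empty => simpa using hT
  | insert i I hi ih =>
    rw [Finset.set_biInter_insert, Set.inter_left_comm]
    exact M.mem_star_inter (hS i (Finset.mem_insert_self i I))
      (ih fun j hj => hS j (Finset.mem_insert_of_mem hj))

theorem stPreimage_subset [TopologicalSpace X] {G : Set X} (hG : IsOpen G) :
    M.stPreimage G ⊆ M.ext (M.starSet G) := by
  rintro y ⟨x, hx, hy⟩
  exact hy G hG hx

variable [MeasurableSpace X]

/-- If an internal probability measure gives mass near `r` to an internal Borel subset of `*G`, then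
it belongs to the extension of the set of all charges that give mass more than `c` to `G`,
for any `c < r`. -/
theorem mem_star_lt_of_approx {ν : M.ISetFun} (hν : M.IsInternalProbability ν) {G : Set X}
    (hG : MeasurableSet G) {B : M.ISet} (hB : M.IsInternalBorel B)
    (hBG : M.ext B ⊆ M.ext (M.starSet G)) {r c : ℝ} (hr : M.Approx (M.app ν B) (M.starReal r))
    (hc : c < r) :
    M.mem ν (M.star (t := .set (.fn (.set .pt) .real))
      {Q : Set X → ULift.{u} ℝ | c < (Q G).down}) := by
  let Γ : List HType := [.set (.fn (.set .pt) .real), .set (.set .pt), .set .pt, .real,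
    .set (.prod .real .real), .set (.fn (.set .pt) .real)]
  -- Says: if `Q` is a charge, `A ⊆ G` is Borel and `r - Q A < r - c`, then `c < Q G`.
  let φ : HFormula Γ :=
    .all (.fn (.set .pt) .real) (.all (.set .pt)
      (.imp (.and (.mem (.var .one) (.var .two)) (.and (.mem (.var .zero) (.var .three))
        (.and (.all .pt (.imp (.mem (.var .zero) (.var .one))
            (.mem (.var .zero) (.var (.succ .four)))))
          (.mem (.pair (.var .five) (.app (.var .one) (.var .zero))) (.var (.succ .five))))))
        (.mem (.var .one) (.var (.succ (.succ .five))))))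
  let e : (stdStructure X).Env Γ :=
    consEnv {P | IsCharge fun A => (P A).down} <| consEnv {A | MeasurableSet A} <| consEnv G <|
    consEnv (s := .real) (ULift.up r) <| consEnv {p | p.1.down - p.2.down < r - c} <|
    consEnv {Q | c < (Q G).down} emptyEnv
  have h1 : (stdStructure X).Holds e φ := fun Q A => holds_imp.2 fun ⟨hQ, hA, hAG, hrA⟩ => by
    have h2 : IsCharge fun A => (Q A).down := hQ
    have h3 : r - (Q A).down < r - c := hrA
    have h4 : (Q A).down ≤ (Q G).down := h2.mono hA hG fun x hx => holds_imp.1 (hAG x) hx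
    have h5 : c < (Q G).down := by linarith
    exact h5
  exact holds_imp.1 ((M.transfer φ e).1 h1 ν B)
    ⟨hν, hB, fun x => holds_imp.2 fun hx => hBG hx, (hr (r - c) (sub_pos.2 hc)).2⟩

/-- On open sets the push-down of `ν` is at most the standard part of `ν`. -/
theorem mem_star_lt_of_lt_pushDown [TopologicalSpace X] [OpensMeasurableSpace X] {ν : M.ISetFun}
    (hν : M.IsInternalProbability ν) {G : Set X} (hG : IsOpen G) {c : ℝ}
    (hc : c < M.pushDown ν G) :
    M.mem ν (M.star (t := .set (.fn (.set .pt) .real))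
      {Q : Set X → ULift.{u} ℝ | c < (Q G).down}) := by
  -- For `c ≥ 0`, `c < sSup` rules out the empty set, whose supremum is 0 by default; negative `c`
  -- needs only nonnegativity of charges.
  obtain hc0 | hc0 := lt_or_ge c 0
  · exact M.mem_star_of_subset
      (fun Q (hQ : IsCharge _) => hc0.trans_le (hQ.nonneg G hG.measurableSet)) hν
  · obtain ⟨r, ⟨B, hB, hBG, hr⟩, hcr⟩ : ∃ r ∈ {r : ℝ | ∃ B : M.ISet, M.IsInternalBorel B ∧
        M.ext B ⊆ M.stPreimage G ∧ M.Approx (M.app ν B) (M.starReal r)}, c < r := by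
      refine exists_lt_of_lt_csSup ?_ hc
      by_contra h
      rw [pushDown, loeb, Set.not_nonempty_iff_eq_empty.1 h, Real.sSup_empty] at hc
      exact hc.not_ge hc0
    exact M.mem_star_lt_of_approx hν hG.measurableSet hB (hBG.trans (M.stPreimage_subset hG)) hr hcr

/-- A bound on the Wasserstein distance from `P` to all elements of a set of charges
transfers to the elements of its extension. -/
theorem approx_starWasserstein_zero {X : Type u} [MetricSpace X] [MeasurableSpace X]
    (M : NonstandardModel.{u, v} X) {ν : M.ISetFun} {P : Set X → ℝ}
    (h : ∀ ε > 0, ∃ S : Set (Set X → ULift.{u} ℝ),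
      M.mem ν (M.star (t := .set (.fn (.set .pt) .real)) S) ∧
        ∀ Q ∈ S, wasserstein (fun A => (Q A).down) P < ε) :
    M.Approx (M.starWasserstein ν (M.starSetFun P)) (M.starReal 0) := by
  intro ε hε
  obtain ⟨S, hνS, hS⟩ := h ε hε
  let Γ : List HType := [.set (.fn (.set .pt) .real), .fn (.set .pt) .real,
    .fn (.prod (.fn (.set .pt) .real) (.fn (.set .pt) .real)) .real, .real,
    .set (.prod .real .real)]
  let w : HTerm (.fn (.set .pt) .real :: Γ) .real :=
    .app (.var .three) (.pair (.var .zero) (.var .two))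
  let φ : HFormula Γ := .all (.fn (.set .pt) .real) (.imp (.mem (.var .zero) (.var .one))
    (.and (.mem (.pair w (.var .four)) (.var .five)) (.mem (.pair (.var .four) w) (.var .five))))
  let e : (stdStructure X).Env Γ :=
    consEnv S <| consEnv (fun A => ULift.up (P A)) <|
    consEnv (fun p => ULift.up (wasserstein (fun A => (p.1 A).down) (fun A => (p.2 A).down))) <|
    consEnv (s := .real) (ULift.up 0) <| consEnv {p | p.1.down - p.2.down < ε} emptyEnv
  have h1 : (stdStructure X).Holds e φ := fun Q => holds_imp.2 fun hQ => by
    have h2 : wasserstein (fun A => (Q A).down) P - 0 < ε := by simpa using hS Q hQ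
    have h3 : 0 - wasserstein (fun A => (Q A).down) P < ε := by
      linarith [wasserstein_nonneg (fun A => (Q A).down) P]
    exact ⟨h2, h3⟩
  exact holds_imp.1 ((M.transfer φ e).1 h1 ν) hνS

end NonstandardModel

theorem mainTheorem4 {X : Type u} [MetricSpace X] [BoundedSpace X] [SigmaCompactSpace X]
    [MeasurableSpace X] [BorelSpace X] (M : NonstandardModel.{u, v} X)
    (ν : M.ISetFun) (hν : M.IsInternalProbability ν)
    (hdom : ∀ C : Set X, MeasurableSet C → C ∈ M.pushDownDomain ν)
    (hpd : IsCountablyAdditiveProbability (M.pushDown ν)) :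
    M.Approx (M.starWasserstein ν (M.starSetFun (M.pushDown ν))) (M.starReal 0) := by
  refine M.approx_starWasserstein_zero fun ε hε => ?_
  obtain ⟨μ, _, hμ⟩ := hpd.exists_measure
  have : Nonempty X := nonempty_of_isProbabilityMeasure μ
  obtain ⟨D, hD0, hD⟩ : ∃ D : ℝ, 0 < D ∧ ∀ x y : X, dist x y ≤ D := by
    obtain ⟨D, hD⟩ := Metric.isBounded_iff.1 (Bornology.IsBounded.all (Set.univ : Set X))
    exact ⟨max D 1, by positivity, fun x y => (hD trivial trivial).trans (le_max_left _ _)⟩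
  -- Chosen so that `6 * D * η + 2 * (ε / 8) = ε / 2`.
  set η : ℝ := ε / (24 * D) with hη
  have hη0 : 0 < η := by positivity
  obtain ⟨n, G, c, hGo, hd, hc, hsum⟩ :=
    exists_disjoint_isOpen_small μ (δ := ε / 8) (by positivity) (div_pos hη0 three_pos)
  have hGm : ∀ i, MeasurableSet (G i) := fun i => (hGo i).measurableSet
  simp only [← hμ _ (hGm _)] at hsum
  -- The `n + 1` avoids division by zero.
  set θ : ℝ := η / 3 / (n + 1) with hθ
  have hθ0 : 0 < θ := by positivity
  have hnθ : n * θ ≤ η / 3 := by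
    rw [hθ, mul_div_assoc', div_le_iff₀ (by positivity)]
    nlinarith
  refine ⟨_, M.mem_star_biInter (Finset.range n) hν fun i _ => M.mem_star_lt_of_lt_pushDown hν
    (hGo i) (sub_lt_self (M.pushDown ν (G i)) hθ0), ?_⟩
  rintro Q ⟨hQ, hQG⟩
  replace hQ : IsCharge fun A => (Q A).down := hQ
  replace hQG : ∀ i ∈ Finset.range n, M.pushDown ν (G i) - θ < (Q (G i)).down := by
    simpa using hQG
  -- If `-θ < x` then `|x| ≤ x + 2 * θ`, so lower bounds suffice: the sum is at most `1 - (1 - η /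
  -- 3) + 2 * (η / 3) = η`.
  have habs : ∑ i ∈ Finset.range n, |(Q (G i)).down - M.pushDown ν (G i)| ≤ η := by
    calc ∑ i ∈ Finset.range n, |(Q (G i)).down - M.pushDown ν (G i)|
        ≤ ∑ i ∈ Finset.range n, ((Q (G i)).down - M.pushDown ν (G i) + 2 * θ) := by
          refine Finset.sum_le_sum fun i hi => abs_le.2 ?_
          constructor <;> linarith [hQG i hi]
      _ = ∑ i ∈ Finset.range n, (Q (G i)).down - ∑ i ∈ Finset.range n, M.pushDown ν (G i)
          + 2 * (n * θ) := by
          rw [Finset.sum_add_distrib, Finset.sum_sub_distrib, Finset.sum_const, Finset.card_range,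
            nsmul_eq_mul]
          ring
      _ ≤ η := by linarith [hQ.sum_le_one (Finset.range n) hGm hd]
  have hW := hpd.isCharge.wasserstein_le hQ hGm hd hD (by positivity : (0 : ℝ) ≤ ε / 8) c
    (fun i _ => hc i) hη0.le (by linarith) habs
  have hDη : 6 * D * η = ε / 4 := by
    rw [hη]
    field_simp
    norm_num
  linarith
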